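/- Let $p$ be a prime number, let $n\ge 3$ be an integer, and let $F$ be a field. Assume that $F$ contains a primitive $p$-th root of unity if $\operatorname{char}(F)\neq p$, and that $-1$ is a square in $F$ if $p=2$. Let $G$ be the absolute Galois group $G_F=\operatorname{Gal}(F_{\mathrm{sep}}/F)$ of $F$ or its maximal pro-$p$ quotient $G_F(p)$. Then for every $\chi\in H^1(G,\mathbb F_p)$ the $n$-fold Massey product $\langle\chi,\ldots,\chi\rangle\subseteq H^2(G,\mathbb F_p)$ is defined and contains $0$. Here $H^i(G,\mathbb F_p)$ is the cohomology of the complex of continuous inhomogeneous cochains of $G$ with values in the trivial discrete module $\mathbb F_p$, with differential $\delta$. A defining system for the $n$-fold Massey product $\langle\alpha_1,\ldots,\alpha_n\rangle$ of classes $\alpha_i\in H^1(G,\mathbb F_p)$ is a family of continuous $1$-cochains $a_{ij}$, $1\le i<j\le n+1$, $(i,j)\ne(1,n+1)$, such that $a_{i,i+1}$ is a cocycle representing $\alpha_i$ for $1\le i\le n$, and $\delta a_{ij}=\sum_{l=i+1}^{j-1}a_{il}\cup a_{lj}$ whenever $i+1<j$. The Massey product is defined if such a system exists; it is then the set of the classes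 of the $2$-cocycles $\sum_{k=2}^{n}a_{1k}\cup a_{k,n+1}$, over all defining systems. -/

import Mathlib

namespace Massey

/-! ## Low degree continuous cochains with trivial coefficients

`G` is a topological group and `ZMod p` is the discrete module `𝔽_p` with trivial action. The
continuous inhomogeneous cochains of degrees `1`, `2`, `3` are the continuous maps from `G`,
`G × G`, `G × G × G` to `ZMod p`, and those of degree `0` are the elements of `ZMod p`. -/

section Cochains

variable (p : ℕ) (G : Type*) [Group G] [TopologicalSpace G] [IsTopologicalGroup G]

/-- Continuous inhomogeneous `1`-cochains. -/
abbrev C1 : Type _ := C(G, ZMod p)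

/-- Continuous inhomogeneous `2`-cochains. -/
abbrev C2 : Type _ := C(G × G, ZMod p)

/-- Continuous inhomogeneous `3`-cochains. -/
abbrev C3 : Type _ := C(G × G × G, ZMod p)

/-- The differential `(δ m)(g) = g • m - m` in degree `0`, where `g • m = m`. -/
def d0 : ZMod p →+ C1 p G where
  toFun m := ⟨fun _ => m - m, continuous_const⟩
  map_zero' := by ext; simp
  map_add' _ _ := by ext; simp

/-- The differential `(δ a)(g, h) = a(h) - a(g h) + a(g)` in degree `1`. -/
def d1 : C1 p G →+ C2 p G where
  toFun a := ⟨fun x => a x.2 - a (x.1 * x.2) + a x.1, by fun_prop⟩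
  map_zero' := by ext; simp
  map_add' a b := by ext; simp; ring

/-- The differential `(δ b)(g, h, k) = b(h, k) - b(g h, k) + b(g, h k) - b(g, h)` in
degree `2`. -/
def d2 : C2 p G →+ C3 p G where
  toFun b := ⟨fun x => b (x.2.1, x.2.2) - b (x.1 * x.2.1, x.2.2) + b (x.1, x.2.1 * x.2.2)
    - b (x.1, x.2.1), by fun_prop⟩
  map_zero' := by ext; simp
  map_add' a b := by ext; simp; ring

/-- `1`-cocycles. -/
def Z1 : AddSubgroup (C1 p G) := (d1 p G).ker

/-- `1`-coboundaries. -/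
def B1 : AddSubgroup (C1 p G) := (d0 p G).range

/-- `2`-cocycles. -/
def Z2 : AddSubgroup (C2 p G) := (d2 p G).ker

/-- `2`-coboundaries. -/
def B2 : AddSubgroup (C2 p G) := (d1 p G).range

/-- Continuous cohomology `H¹(G, 𝔽_p)`. -/
abbrev H1 : Type _ := Z1 p G ⧸ (B1 p G).addSubgroupOf (Z1 p G)

/-- Continuous cohomology `H²(G, 𝔽_p)`. -/
abbrev H2 : Type _ := Z2 p G ⧸ (B2 p G).addSubgroupOf (Z2 p G)

variable {p G}

/-- The class of a `1`-cocycle in `H¹(G, 𝔽_p)`. -/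
def class1 (z : Z1 p G) : H1 p G := QuotientAddGroup.mk z

/-- The class of a `2`-cocycle in `H²(G, 𝔽_p)`. -/
def class2 (z : Z2 p G) : H2 p G := QuotientAddGroup.mk z

/-- The cup product `(a ∪ b)(g, h) = a(g) b(h)` of two `1`-cochains. -/
def cup (a b : C1 p G) : C2 p G := ⟨fun x => a x.1 * b x.2, by fun_prop⟩

/-! ## Massey products -/

/-- A defining system for the `n`-fold Massey product `⟨α₀, …, α_{n-1}⟩`. The rows and columns are
numbered `0, …, n`. Only the entries `a i j` with `i < j` and `(i, j) ≠ (0, n)` are meaningful: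
the other ones are neither constrained nor used. -/
structure DefiningSystem {n : ℕ} (α : Fin n → H1 p G) where
  /-- The entries of the defining system. -/
  a : Fin (n + 1) → Fin (n + 1) → C1 p G
  /-- The entries next to the diagonal are cocycles. -/
  isCocycle : ∀ i : Fin n, a i.castSucc i.succ ∈ Z1 p G
  /-- The entries next to the diagonal represent the given classes. -/
  represents : ∀ i : Fin n, class1 ⟨a i.castSucc i.succ, isCocycle i⟩ = α i
  /-- The defining equations. -/
  d_eq : ∀ i j : Fin (n + 1), i.val + 1 < j.val → (i, j) ≠ (0, Fin.last n) →
    d1 p G (a i j) = ∑ l ∈ Finset.Ioo i j, cup (a i l) (a l j)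

namespace DefiningSystem

variable {n : ℕ} {α : Fin n → H1 p G} (M : DefiningSystem α)

/-- The `2`-cochain `∑ a_{0,k} ∪ a_{k,n}`, the sum being over `0 < k < n`. -/
def cochain : C2 p G :=
  ∑ k ∈ Finset.Ioo 0 (Fin.last n), cup (M.a 0 k) (M.a k (Fin.last n))

theorem d1_eq (i j : Fin (n + 1)) (hij : i < j) (h : (i, j) ≠ (0, Fin.last n)) :
    d1 p G (M.a i j) = ∑ l ∈ Finset.Ioo i j, cup (M.a i l) (M.a l j) := by
  by_cases h1 : i.val + 1 < j.val
  · exact M.d_eq i j h1 h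
  · have hv : i.val + 1 = j.val := by have := Fin.lt_def.mp hij; omega
    have hn : i.val < n := by omega
    have hi : i = (⟨i.val, hn⟩ : Fin n).castSucc := rfl
    have hj : j = (⟨i.val, hn⟩ : Fin n).succ := by ext; simp [hv]
    have he : Finset.Ioo i j = ∅ := by
      ext l
      simp only [Finset.mem_Ioo, Fin.lt_def, Finset.notMem_empty, iff_false]
      omega
    rw [he, Finset.sum_empty]
    have := M.isCocycle ⟨i.val, hn⟩
    rw [← hi, ← hj] at this
    exact this

theorem d2_cup (a b : C1 p G) (x : G × G × G) :
    d2 p G (cup a b) x = d1 p G a (x.1, x.2.1) * b x.2.2 - a x.1 * d1 p G b x.2 := by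
  simp [d1, d2, cup]
  ring

theorem cochain_mem : M.cochain ∈ Z2 p G := by
  change d2 p G M.cochain = 0
  ext x
  have e1 : ∀ k ∈ Finset.Ioo 0 (Fin.last n),
      d2 p G (cup (M.a 0 k) (M.a k (Fin.last n))) x =
      (∑ l ∈ Finset.Ioo 0 k, M.a 0 l x.1 * M.a l k x.2.1 * M.a k (Fin.last n) x.2.2) -
      ∑ l ∈ Finset.Ioo k (Fin.last n),
        M.a 0 k x.1 * M.a k l x.2.1 * M.a l (Fin.last n) x.2.2 := by
    intro k hk
    rw [Finset.mem_Ioo] at hk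
    rw [d2_cup, M.d1_eq 0 k hk.1 (by simp [hk.2.ne]),
      M.d1_eq k (Fin.last n) hk.2 (by simp [hk.1.ne'])]
    simp only [ContinuousMap.coe_sum, Finset.sum_apply, cup, ContinuousMap.coe_mk,
      Finset.sum_mul, Finset.mul_sum, mul_assoc]
  rw [cochain, map_sum]
  simp only [ContinuousMap.coe_sum, Finset.sum_apply, ContinuousMap.coe_zero, Pi.zero_apply]
  rw [Finset.sum_congr rfl e1, Finset.sum_sub_distrib, sub_eq_zero]
  refine Finset.sum_comm' ?_
  intro k l
  simp only [Finset.mem_Ioo]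
  constructor
  · rintro ⟨⟨h1, h2⟩, h3, h4⟩
    exact ⟨⟨h4, h2⟩, h3, h4.trans h2⟩
  · rintro ⟨⟨h1, h2⟩, h3, h4⟩
    exact ⟨⟨h3.trans h1, h2⟩, h3, h1⟩

/-- The value in `H²(G, 𝔽_p)` of the Massey product relative to the defining system. -/
def value : H2 p G := class2 ⟨M.cochain, M.cochain_mem⟩

end DefiningSystem

/-- The Massey product `⟨α₀, …, α_{n-1}⟩` is defined: it has a defining system. -/
def IsDefined {n : ℕ} (α : Fin n → H1 p G) : Prop := Nonempty (DefiningSystem α)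

/-- The Massey product `⟨α₀, …, α_{n-1}⟩`, a subset of `H²(G, 𝔽_p)`. -/
def masseyProduct {n : ℕ} (α : Fin n → H1 p G) : Set (H2 p G) :=
  Set.range fun M : DefiningSystem α => M.value

end Cochains

/-! ## Galois groups -/

/-- The intersection of all open normal subgroups `N` of `G` such that `G ⧸ N` is a `p`-group. -/
def proPKernel (p : ℕ) (G : Type*) [Group G] [TopologicalSpace G] : Subgroup G :=
  ⨅ (N : OpenNormalSubgroup G) (_ : IsPGroup p (G ⧸ N.toSubgroup)), N.toSubgroup

instance proPKernel_normal (p : ℕ) (G : Type*) [Group G] [TopologicalSpace G] :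
    (proPKernel p G).Normal :=
  Subgroup.normal_iInf_normal fun N => Subgroup.normal_iInf_normal fun _ => N.isNormal'

/-- The maximal pro-`p` quotient of a profinite group, with the quotient topology. -/
abbrev MaximalProPQuotient (p : ℕ) (G : Type*) [Group G] [TopologicalSpace G] : Type _ :=
  G ⧸ proPKernel p G

/-- The absolute Galois group `Gal(F_sep / F)` of a field, with the Krull topology. -/
abbrev AbsGal (F : Type*) [Field F] : Type _ := Gal(SeparableClosure F/F)

end Massey

/-!
A unipotent representation `ρ : G → U_{n+1}(𝔽_p)` whose entries next to the diagonal all equal `-χ`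
yields, after changing the sign of its entries, a defining system for `⟨χ, …, χ⟩` together with a
cochain that trivializes its value. So it suffices to construct, for every character `χ` of
the absolute Galois group, such a representation with `χ` next to the diagonal. Since its image is a
`p`-group, it factors through the maximal pro-`p` quotient, which settles that case as well
(`IsUnipotentLift.zero_mem_masseyProduct`, `IsUnipotentLift.exists_quotient`).

The representations act on `𝔽_p[X] / (X ^ (n + 1))` by operators `f ↦ P * f(Q)` with `P(0) = 1` and
`Q ≡ X` modulo `X ^ 3`; in the basis of monomials the entries next to the diagonal are all equal to
the linear coefficient of `P` (`exists_isUnipotentLift_of_substitution`).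

If the characteristic is not `p`, then `χ` is the Kummer character of some `a`. For a large power
`q` of `p`, a root `β` of `β ^ q = a` and a primitive `q`-th root of unity `ξ`, an automorphism `σ`
satisfies `σ β = ξ ^ c * β` and `σ ξ = ξ ^ u`, and `σ ↦ (c, u)` is a homomorphism to the affine group
of `ℤ / q`. That group acts by `P = (1 + X) ^ c`, `Q = (1 + X) ^ u - 1`. The linear coefficient of `P`
is `c ≡ χ(σ)`. The coefficients of `X` and `X ^ 2` in `Q` are `u` and `u (u - 1) / 2`; they are `1`
and `0` in `𝔽_p` because `u ≡ 1` modulo `p`, as `F` contains the `p`-th roots of unity, and, for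
`p = 2`, because `u ≡ 1` modulo `4`, as `F` contains a square root of `-1`
(`exists_isUnipotentLift_of_char_ne`).

If the characteristic is `p`, then `χ(σ) = σ θ - θ` for an Artin–Schreier generator `θ`. With `Φ` the
Frobenius map on coefficients, the equation `Φ C = (1 + (θ ^ p - θ) X) C` has a solution
`C = 1 + θ X + ⋯`, and `P = σ C / C`, `Q = X` defines the representation
(`exists_isUnipotentLift_of_charP`).

The Kummer and Artin–Schreier generators are Lagrange resolvents; both come from
`exists_resolvent_ne_zero`.
-/

namespace Massey

/-! ### Defining systems from unipotent representations -/

/-- `ρ` is a continuous representation of `G` by upper unitriangular matrices of size `n + 1` over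
`𝔽_p`, all of whose entries next to the diagonal are equal to `χ`. Continuity is expressed entry by
entry. -/
structure IsUnipotentLift {p n : ℕ} {G : Type*} [Group G] [TopologicalSpace G] (χ : G → ZMod p)
    (ρ : G →* Matrix (Fin (n + 1)) (Fin (n + 1)) (ZMod p)) : Prop where
  continuous : ∀ i j, Continuous fun g => ρ g i j
  upper : ∀ g i j, j < i → ρ g i j = 0
  diag : ∀ g i, ρ g i i = 1
  superdiag : ∀ g (i : Fin n), ρ g i.castSucc i.succ = χ g

section UnipotentLift

variable {p n : ℕ} {G : Type*} [Group G] [TopologicalSpace G]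

theorem IsUnipotentLift.apply_mul {χ : G → ZMod p}
    {ρ : G →* Matrix (Fin (n + 1)) (Fin (n + 1)) (ZMod p)} (hρ : IsUnipotentLift χ ρ) (g h : G)
    {i j : Fin (n + 1)} (hij : i < j) :
    ρ (g * h) i j = ρ h i j + ρ g i j + ∑ l ∈ Finset.Ioo i j, ρ g i l * ρ h l j := by
  rw [map_mul, Matrix.mul_apply, ← Finset.sum_subset (Finset.subset_univ (Finset.Icc i j)),
    ← Finset.Ico_insert_right hij.le, Finset.sum_insert Finset.right_notMem_Ico,
    ← Finset.Ioo_insert_left hij, Finset.sum_insert Finset.left_notMem_Ioo, hρ.diag, hρ.diag]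
  · ring
  · intro l _ hl
    rw [Finset.mem_Icc, not_and_or, not_le, not_le] at hl
    rcases hl with hl | hl
    · rw [hρ.upper g i l hl, zero_mul]
    · rw [hρ.upper h l j hl, mul_zero]

variable [IsTopologicalGroup G]

/-- The negatives of the entries of a unipotent representation form a defining system, the corner
entry of which trivializes its value. The sign comes from `δ a (g, h) = a h - a (g h) + a g`. -/
theorem IsUnipotentLift.zero_mem_masseyProduct {χ : Z1 p G}
    {ρ : G →* Matrix (Fin (n + 1)) (Fin (n + 1)) (ZMod p)}
    (hρ : IsUnipotentLift (fun g => -χ.1 g) ρ) (hn : n ≠ 0) :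
    (0 : H2 p G) ∈ masseyProduct (fun _ : Fin n => class1 χ) := by
  let a : Fin (n + 1) → Fin (n + 1) → C1 p G := fun i j =>
    -⟨fun g => ρ g i j, hρ.continuous i j⟩
  have ha : ∀ i : Fin n, a i.castSucc i.succ = χ.1 := by
    intro i
    ext g
    simp [a, hρ.superdiag]
  have hd : ∀ i j : Fin (n + 1), i < j →
      d1 p G (a i j) = ∑ l ∈ Finset.Ioo i j, cup (a i l) (a l j) := by
    intro i j hij
    ext x
    have := hρ.apply_mul x.1 x.2 hij
    simp only [d1, cup, a, AddMonoidHom.coe_mk, ZeroHom.coe_mk, ContinuousMap.coe_mk,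
      ContinuousMap.coe_neg, Pi.neg_apply, ContinuousMap.coe_sum, Finset.sum_apply, neg_mul_neg]
    rw [this]
    ring
  let M : DefiningSystem (fun _ : Fin n => class1 χ) :=
    { a := a
      isCocycle := fun i => by rw [ha]; exact χ.2
      represents := fun i => by
        congr 1
        exact Subtype.ext (ha i)
      d_eq := fun i j hij _ => hd i j (Fin.lt_def.mpr (by omega)) }
  refine ⟨M, ?_⟩
  refine (QuotientAddGroup.eq_zero_iff _).mpr ?_
  rw [AddSubgroup.mem_addSubgroupOf]
  exact ⟨a 0 (Fin.last n), hd 0 (Fin.last n) (Fin.pos_iff_ne_zero.mpr (by simpa using hn))⟩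

end UnipotentLift

/-! ### Passage to the maximal pro-`p` quotient -/

section ProP

variable {p n : ℕ} [Fact p.Prime]

theorem exists_pow_prime_pow_eq_one_of_unitriangular
    (A : Matrix (Fin (n + 1)) (Fin (n + 1)) (ZMod p)) (hu : ∀ i j, j < i → A i j = 0)
    (hd : ∀ i, A i i = 1) : ∃ k : ℕ, A ^ p ^ k = 1 := by
  have hc : A.charpoly = (Polynomial.X - 1) ^ (n + 1) := by
    rw [Matrix.charpoly_of_isUpperTriangular A (fun i j h => hu i j h)]
    simp [hd]
  have h0 : (A - 1) ^ (n + 1) = 0 := by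
    have := A.aeval_self_charpoly
    rwa [hc, map_pow, map_sub, Polynomial.aeval_X, map_one] at this
  refine ⟨n + 1, ?_⟩
  have h1 : (A - 1) ^ p ^ (n + 1) = 0 :=
    pow_eq_zero_of_le (Nat.lt_pow_self (Fact.out : p.Prime).one_lt).le h0
  rwa [sub_pow_char_pow_of_commute p _ (Commute.one_right A), one_pow, sub_eq_zero] at h1

/-- The kernel of a unipotent representation over `𝔽_p` is open and the quotient by it is a
`p`-group. -/
theorem IsUnipotentLift.proPKernel_le_ker {G : Type*} [Group G] [TopologicalSpace G]
    {χ : G → ZMod p} {ρ : G →* Matrix (Fin (n + 1)) (Fin (n + 1)) (ZMod p)}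
    (hρ : IsUnipotentLift χ ρ) : proPKernel p G ≤ ρ.ker := by
  have ho : IsOpen (ρ.ker : Set G) := by
    have : (ρ.ker : Set G) =
        ⋂ i, ⋂ j, (fun g => ρ g i j) ⁻¹' {(1 : Matrix (Fin (n + 1)) (Fin (n + 1)) (ZMod p)) i j} := by
      ext g
      simp only [SetLike.mem_coe, MonoidHom.mem_ker, Set.mem_iInter, Set.mem_preimage,
        Set.mem_singleton_iff]
      exact Matrix.ext_iff.symm
    rw [this]
    exact isOpen_iInter_of_finite fun i => isOpen_iInter_of_finite fun j =>
      (isOpen_discrete _).preimage (hρ.continuous i j)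
  let N : OpenNormalSubgroup G := { ρ.ker with isOpen' := ho, isNormal' := ρ.normal_ker }
  refine iInf₂_le_of_le N ?_ le_rfl
  intro q
  induction q using QuotientGroup.induction_on with
  | H g =>
    obtain ⟨k, hk⟩ := exists_pow_prime_pow_eq_one_of_unitriangular (ρ g) (hρ.upper g) (hρ.diag g)
    refine ⟨k, ?_⟩
    rw [← QuotientGroup.mk_pow, QuotientGroup.eq_one_iff]
    exact (MonoidHom.mem_ker).mpr (by rw [map_pow, hk])

theorem IsUnipotentLift.exists_quotient {G : Type*} [Group G] [TopologicalSpace G]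
    {χ : MaximalProPQuotient p G → ZMod p}
    {ρ : G →* Matrix (Fin (n + 1)) (Fin (n + 1)) (ZMod p)}
    (hρ : IsUnipotentLift (fun g => χ (QuotientGroup.mk g)) ρ) :
    ∃ ρ' : MaximalProPQuotient p G →* Matrix (Fin (n + 1)) (Fin (n + 1)) (ZMod p),
      IsUnipotentLift χ ρ' := by
  refine ⟨QuotientGroup.lift _ ρ hρ.proPKernel_le_ker, ?_, ?_, ?_, ?_⟩
  · intro i j
    exact (QuotientGroup.isQuotientMap_mk (proPKernel p G)).continuous_iff.mpr
      (hρ.continuous i j)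
  · rintro ⟨g⟩ i j h
    exact hρ.upper g i j h
  · rintro ⟨g⟩ i
    exact hρ.diag g i
  · rintro ⟨g⟩ i
    exact hρ.superdiag g i

end ProP

/-! ### Unipotent representations from substitutions -/

section Substitution

open Polynomial

variable {p n : ℕ} {G : Type*} [Group G]

theorem coeff_eq_of_X_pow_dvd_sub {R : Type*} [CommRing R] {A B : R[X]} {N i : ℕ}
    (h : X ^ N ∣ A - B) (hi : i < N) : A.coeff i = B.coeff i :=
  sub_eq_zero.mp (by rw [← coeff_sub]; exact X_pow_dvd_iff.mp h i hi)

/-- Composing the operators `f ↦ A * f(B)` corresponds to multiplying their matrices in the basis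
of monomials. -/
theorem coeff_mul_comp_eq_sum {R : Type*} [CommRing R] {A B : R[X]} (hB : X ∣ B) (f : R[X])
    {N i : ℕ} (hi : i < N) :
    (A * f.comp B).coeff i = ∑ l ∈ Finset.range N, (A * B ^ l).coeff i * f.coeff l := by
  have h0 : ∀ l, i < l → (A * B ^ l).coeff i = 0 := fun l hl =>
    X_pow_dvd_iff.mp ((pow_dvd_pow_of_dvd hB l).mul_left A) i hl
  have h1 : f.comp B = ∑ l ∈ Finset.range (f.natDegree + 1 + N), C (f.coeff l) * B ^ l :=
    eval₂_eq_sum_range' C (by omega) B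
  rw [h1, Finset.mul_sum, finsetSum_coeff]
  have h2 : ∀ l, (A * (C (f.coeff l) * B ^ l)).coeff i = (A * B ^ l).coeff i * f.coeff l := by
    intro l
    rw [mul_left_comm, coeff_C_mul, mul_comm]
  simp only [h2]
  refine (Finset.sum_subset (Finset.range_mono (by omega)) fun l _ hl => ?_).symm
  rw [Finset.mem_range, not_lt] at hl
  rw [h0 l (by omega), zero_mul]

theorem dvd_mul_pow_sub_mul_pow {R : Type*} [CommRing R] {N A A' B B' : R} (hA : N ∣ A - A')
    (hB : N ∣ B - B') (j : ℕ) : N ∣ A * B ^ j - A' * B' ^ j := by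
  have h : A * B ^ j - A' * B' ^ j = (A - A') * B ^ j + A' * (B ^ j - B' ^ j) := by ring
  rw [h]
  exact dvd_add (hA.mul_right _) ((hB.trans (sub_dvd_pow_sub_pow B B' j)).mul_left _)

/-- A family of substitution operators `f ↦ P g * f(Q g)` on `𝔽_p[X] / (X ^ (n + 1))` that is
multiplicative in `g` gives a unipotent representation. The condition `Q g ≡ X` modulo `X ^ 3`
makes the entries next to the diagonal independent of the position. -/
theorem exists_isUnipotentLift_of_substitution [TopologicalSpace G] (P Q : G → (ZMod p)[X])
    (hPc : IsLocallyConstant P) (hQc : IsLocallyConstant Q)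
    (hP0 : ∀ g, (P g).coeff 0 = 1) (hQ : ∀ g, X ^ 3 ∣ Q g - X)
    (h1 : X ^ (n + 1) ∣ P 1 - 1) (hQ1 : X ^ (n + 1) ∣ Q 1 - X)
    (hP : ∀ g h, X ^ (n + 1) ∣ P (g * h) - P g * (P h).comp (Q g))
    (hQm : ∀ g h, X ^ (n + 1) ∣ Q (g * h) - (Q h).comp (Q g)) :
    ∃ ρ : G →* Matrix (Fin (n + 1)) (Fin (n + 1)) (ZMod p),
      IsUnipotentLift (fun g => (P g).coeff 1) ρ := by
  have hX : ∀ g, ∃ R : (ZMod p)[X], Q g = X * R ∧ R.coeff 0 = 1 ∧ R.coeff 1 = 0 := by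
    intro g
    obtain ⟨S, hS⟩ := hQ g
    refine ⟨1 + X ^ 2 * S, ?_, ?_, ?_⟩
    · linear_combination hS
    · simp
    · simp [coeff_one, coeff_X_pow_mul']
  have hdvd : ∀ g, X ∣ Q g := fun g => (hX g).imp fun R h => h.1
  have h0 : ∀ g (i j : ℕ), i < j → (P g * Q g ^ j).coeff i = 0 := fun g i j hij =>
    X_pow_dvd_iff.mp ((pow_dvd_pow_of_dvd (hdvd g) j).mul_left (P g)) i hij
  have hd : ∀ g (i : ℕ), (P g * Q g ^ i).coeff i = 1 := by
    intro g i
    obtain ⟨R, hR, hR0, -⟩ := hX g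
    rw [hR, mul_pow, mul_left_comm, coeff_X_pow_mul', if_pos le_rfl, Nat.sub_self,
      mul_coeff_zero, hP0, one_mul, coeff_zero_eq_eval_zero, eval_pow, ← coeff_zero_eq_eval_zero,
      hR0, one_pow]
  have hs : ∀ g (i : ℕ), (P g * Q g ^ i).coeff (i + 1) = (P g).coeff 1 := by
    intro g i
    obtain ⟨R, hR, hR0, hR1⟩ := hX g
    have hRi : (R ^ i).coeff 0 = 1 ∧ (R ^ i).coeff 1 = 0 := by
      induction i with
      | zero => simp [coeff_one]
      | succ i ih => simp [pow_succ, mul_coeff_zero, mul_coeff_one, ih, hR0, hR1]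
    rw [hR, mul_pow, mul_left_comm, coeff_X_pow_mul', if_pos (by omega), Nat.add_sub_cancel_left,
      mul_coeff_one, hRi.1, hRi.2, mul_zero, zero_add, mul_one]
  have hm : ∀ g h (i j : ℕ), i < n + 1 → (P (g * h) * Q (g * h) ^ j).coeff i =
      ∑ l ∈ Finset.range (n + 1), (P g * Q g ^ l).coeff i * (P h * Q h ^ j).coeff l := by
    intro g h i j hi
    rw [← coeff_mul_comp_eq_sum (hdvd g) _ hi]
    refine coeff_eq_of_X_pow_dvd_sub ?_ hi
    rw [mul_comp, pow_comp, ← mul_assoc]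
    exact dvd_mul_pow_sub_mul_pow (hP g h) (hQm g h) j
  -- The matrices of the operators are lower triangular; reversing the basis makes them upper
  -- triangular.
  let ρ : G →* Matrix (Fin (n + 1)) (Fin (n + 1)) (ZMod p) :=
    { toFun := fun g => Matrix.of fun i j => (P g * Q g ^ (j.rev : ℕ)).coeff (i.rev : ℕ)
      map_one' := by
        ext i j
        rw [Matrix.of_apply, coeff_eq_of_X_pow_dvd_sub (dvd_mul_pow_sub_mul_pow h1 hQ1 _)
          i.rev.isLt, one_mul, coeff_X_pow, Matrix.one_apply]
        simp only [Fin.val_inj, Fin.rev_inj]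
      map_mul' := fun g h => by
        ext i j
        rw [Matrix.of_apply, hm g h _ _ i.rev.isLt, Matrix.mul_apply, Finset.sum_range]
        exact (Equiv.sum_comp Fin.revPerm fun l : Fin (n + 1) =>
          (P g * Q g ^ (l : ℕ)).coeff (i.rev : ℕ) * (P h * Q h ^ (j.rev : ℕ)).coeff l).symm }
  refine ⟨ρ, ?_, ?_, ?_, ?_⟩
  · intro i j
    exact ((hPc.prodMk hQc).comp fun x : (ZMod p)[X] × (ZMod p)[X] =>
      (x.1 * x.2 ^ (j.rev : ℕ)).coeff (i.rev : ℕ)).continuous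
  · intro g i j hij
    exact h0 g _ _ (Fin.lt_def.mp (Fin.rev_lt_rev.mpr hij))
  · intro g i
    exact hd g _
  · intro g i
    have hi : ((i.castSucc.rev : Fin (n + 1)) : ℕ) = (i.succ.rev : ℕ) + 1 := by
      simp only [Fin.val_rev, Fin.val_castSucc, Fin.val_succ]
      omega
    change (P g * Q g ^ (i.succ.rev : ℕ)).coeff (i.castSucc.rev : ℕ) = _
    rw [hi, hs]

end Substitution

/-! ### Kummer and Artin–Schreier generators -/

section Resolvent

variable {p : ℕ} [Fact p.Prime] {F K : Type*} [Field F] [Field K] [Algebra F K]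

theorem isLocallyConstant_apply [Algebra.IsIntegral F K] (x : K) :
    IsLocallyConstant fun σ : Gal(K/F) => σ x := by
  let : TopologicalSpace K := ⊥
  have : DiscreteTopology K := ⟨rfl⟩
  have : ContinuousSMul Gal(K/F) K :=
    continuousSMul_iff_stabilizer_isOpen.mpr stabilizer_isOpen_of_isIntegral
  rw [IsLocallyConstant.iff_continuous]
  exact continuous_id.smul continuous_const

/-- The existence of nonzero Lagrange resolvents for a character `χ` with values in `ZMod p`: the
family `v` consists of the conjugates, indexed by `ZMod p`, of an element of the fixed field of the
kernel of `χ`. The sum can be made nonzero by the linear independence of characters. For `χ = 0`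
the condition on `v` only says that its members are invariant, and an indicator function serves. -/
theorem exists_resolvent_ne_zero [IsGalois F K] {χ : Gal(K/F) → ZMod p} (hc : Continuous χ)
    (hχ : ∀ σ τ, χ (σ * τ) = χ σ + χ τ) (w : ZMod p → K) (hw : w 0 ≠ 0) :
    ∃ v : ZMod p → K, (∀ (σ : Gal(K/F)) i, σ (v i) = v (i + χ σ)) ∧ ∑ i, w i * v i ≠ 0 := by
  by_cases h0 : ∀ σ, χ σ = 0
  · exact ⟨fun i => if i = 0 then 1 else 0, fun σ i => by simp [h0, apply_ite σ], by simpa using hw⟩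
  push Not at h0
  obtain ⟨σ₀, hσ₀⟩ := h0
  let f : Gal(K/F) →* Multiplicative (ZMod p) := MonoidHom.mk' (fun σ => .ofAdd (χ σ)) hχ
  have hpow : ∀ σ (k : ℕ), χ (σ ^ k) = k * χ σ := fun σ k => by
    have : χ (σ ^ k) = k • χ σ := map_pow f σ k
    rw [this, nsmul_eq_mul]
  have hinv : ∀ σ, χ σ⁻¹ = -χ σ := fun σ => map_inv f σ
  obtain ⟨τ, hτ⟩ : ∃ τ, χ τ = 1 :=
    ⟨σ₀ ^ (χ σ₀)⁻¹.val, by rw [hpow, ZMod.natCast_zmod_val, inv_mul_cancel₀ hσ₀]⟩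
  have hτi : ∀ i : ZMod p, χ (τ ^ i.val) = i := fun i => by
    rw [hpow, hτ, ZMod.natCast_zmod_val, mul_one]
  let H : ClosedSubgroup Gal(K/F) :=
    { f.ker with isClosed' := (isClosed_discrete ({0} : Set (ZMod p))).preimage hc }
  have hH : ∀ σ, σ ∈ H.1 ↔ χ σ = 0 := fun σ => Iff.rfl
  let E := IntermediateField.fixedField H.1
  have hE : E.fixingSubgroup = H.1 := InfiniteGalois.fixingSubgroup_fixedField H
  let g : ZMod p → (E →* K) := fun i =>
    ((τ ^ i.val : Gal(K/F)) : K →* K).comp (algebraMap E K : E →* K)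
  have hg : Function.Injective g := by
    intro i j hij
    have hmem : (τ ^ j.val)⁻¹ * τ ^ i.val ∈ E.fixingSubgroup := by
      rw [IntermediateField.mem_fixingSubgroup_iff]
      intro x hx
      have := DFunLike.congr_fun hij ⟨x, hx⟩
      change (τ ^ i.val : Gal(K/F)) x = (τ ^ j.val : Gal(K/F)) x at this
      rw [AlgEquiv.mul_apply, this, ← AlgEquiv.mul_apply, inv_mul_cancel,
        AlgEquiv.one_apply]
    rw [hE, hH, hχ, hinv, hτi, hτi] at hmem
    exact (neg_add_eq_zero.mp hmem).symm
  have hli : LinearIndependent K fun i => (g i : E → K) := (linearIndependent_monoidHom E K).comp g hg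
  obtain ⟨y, hy⟩ : ∃ y : E, ∑ i, w i * g i y ≠ 0 := by
    by_contra! hall
    refine hw (Fintype.linearIndependent_iff.mp hli w ?_ 0)
    ext y
    simpa using hall y
  refine ⟨fun i => g i y, fun σ i => ?_, hy⟩
  have hmem : (τ ^ (i + χ σ).val)⁻¹ * (σ * τ ^ i.val) ∈ H.1 := by
    rw [hH, hχ, hχ, hinv, hτi, hτi]
    ring
  have hfix := (IntermediateField.mem_fixedField_iff _ _).mp y.2 _ hmem
  have := congrArg (τ ^ (i + χ σ).val : Gal(K/F)) hfix
  rwa [← AlgEquiv.mul_apply, mul_inv_cancel_left] at this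

/-- Kummer theory: if `ζ` is a primitive `p`-th root of unity, then `χ` is the Kummer character of
`α ^ p`. Only `ζ ^ p = 1` is needed for the resolvent `α`. -/
theorem exists_kummer_generator [IsGalois F K] {χ : Gal(K/F) → ZMod p} (hc : Continuous χ)
    (hχ : ∀ σ τ, χ (σ * τ) = χ σ + χ τ) {ζ : K} (hζ : ζ ^ p = 1)
    (hfix : ∀ σ : Gal(K/F), σ ζ = ζ) :
    ∃ α : K, α ≠ 0 ∧ ∀ σ : Gal(K/F), σ α = ζ ^ (χ σ).val * α := by
  have he : ∀ a b : ZMod p, ζ ^ (a + b).val = ζ ^ a.val * ζ ^ b.val := fun a b => by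
    rw [ZMod.val_add, ← pow_eq_pow_mod _ hζ, pow_add]
  obtain ⟨v, hv, hne⟩ := exists_resolvent_ne_zero hc hχ (fun i => ζ ^ (-i).val) (by simp)
  refine ⟨_, hne, fun σ => ?_⟩
  simp only [map_sum, map_mul, map_pow, hfix, hv, Finset.mul_sum]
  refine Fintype.sum_equiv (Equiv.addRight (χ σ)) _ _ fun i => ?_
  rw [Equiv.coe_addRight, ← mul_assoc, ← he]
  congr 3
  ring

/-- Artin–Schreier theory: in characteristic `p`, every character is an additive coboundary with
values in `K`. -/
theorem exists_artinSchreier_generator [IsGalois F K] [CharP K p] {χ : Gal(K/F) → ZMod p}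
    (hc : Continuous χ) (hχ : ∀ σ τ, χ (σ * τ) = χ σ + χ τ) :
    ∃ θ : K, ∀ σ : Gal(K/F), σ θ = θ + ZMod.castHom dvd_rfl K (χ σ) := by
  set e := ZMod.castHom (dvd_refl p) K
  have he : ∀ (σ : Gal(K/F)) a, σ (e a) = e a := fun σ a =>
    DFunLike.congr_fun (Subsingleton.elim ((σ : K →+* K).comp e) e) a
  obtain ⟨v, hv, hne⟩ := exists_resolvent_ne_zero hc hχ (fun _ => (1 : K)) one_ne_zero
  have ht : ∀ σ : Gal(K/F), σ (∑ i, 1 * v i) = ∑ i, 1 * v i := by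
    intro σ
    simp only [map_sum, one_mul, hv]
    exact Fintype.sum_equiv (Equiv.addRight (χ σ)) _ _ fun i => rfl
  set t := ∑ i, 1 * v i
  refine ⟨(∑ i, e (-i) * v i) / t, fun σ => ?_⟩
  rw [map_div₀, ht, div_eq_iff hne, add_mul, div_mul_cancel₀ _ hne, Finset.mul_sum,
    ← Finset.sum_add_distrib, map_sum]
  refine Fintype.sum_equiv (Equiv.addRight (χ σ)) _ _ fun i => ?_
  rw [Equiv.coe_addRight, map_mul, he, hv, one_mul, ← add_mul, ← map_add]
  congr 2
  ring

end Resolvent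

/-! ### Characteristic different from `p` -/

section Kummer

open Polynomial

variable {p : ℕ} [Fact p.Prime]

theorem X_pow_dvd_one_add_X_pow_sub {m a b : ℕ} (h : a ≡ b [MOD p ^ m]) :
    (X : (ZMod p)[X]) ^ p ^ m ∣ (1 + X) ^ a - (1 + X) ^ b := by
  wlog hab : a ≤ b generalizing a b
  · exact (dvd_sub_comm).mp (this h.symm (le_of_not_ge hab))
  obtain ⟨k, hk⟩ := (Nat.modEq_iff_dvd' hab).mp h
  obtain rfl : b = a + p ^ m * k := by omega
  have h1 : (1 + X : (ZMod p)[X]) ^ p ^ m - 1 = X ^ p ^ m := by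
    rw [add_pow_char_pow, one_pow, add_sub_cancel_left]
  have h2 : (X : (ZMod p)[X]) ^ p ^ m ∣ ((1 + X) ^ p ^ m) ^ k - 1 ^ k :=
    h1 ▸ sub_dvd_pow_sub_pow _ _ _
  rw [dvd_sub_comm, pow_add, pow_mul]
  have h3 : (1 + X : (ZMod p)[X]) ^ a * ((1 + X) ^ p ^ m) ^ k - (1 + X) ^ a =
      (1 + X) ^ a * (((1 + X) ^ p ^ m) ^ k - 1 ^ k) := by
    rw [one_pow]
    ring
  rw [h3]
  exact h2.mul_left _

theorem X_pow_three_dvd_one_add_X_pow_sub {u : ℕ} (h : u ≡ 1 [MOD p])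
    (h4 : p = 2 → u ≡ 1 [MOD 4]) : (X : (ZMod p)[X]) ^ 3 ∣ (1 + X) ^ u - 1 - X := by
  have hu : (u : ZMod p) = 1 := by
    simpa using (ZMod.natCast_eq_natCast_iff u 1 p).mpr h
  have hc : ((u.choose 2 : ℕ) : ZMod p) = 0 := by
    by_cases hp : p = 2
    · subst hp
      rw [ZMod.natCast_eq_zero_iff, Nat.choose_two_right]
      have h4' : u % 4 = 1 := h4 rfl
      obtain ⟨k, rfl⟩ : ∃ k, u = 4 * k + 1 := ⟨u / 4, by omega⟩
      have : (4 * k + 1) * (4 * k + 1 - 1) = 2 * (2 * ((4 * k + 1) * k)) := by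
        rw [Nat.add_sub_cancel]
        ring
      rw [this, Nat.mul_div_cancel_left _ two_pos]
      exact dvd_mul_right _ _
    · have h2 : (2 : ZMod p) ≠ 0 := by
        intro h2
        have : p ∣ 2 := (ZMod.natCast_eq_zero_iff 2 p).mp (by exact_mod_cast h2)
        exact hp ((Nat.prime_dvd_prime_iff_eq Fact.out Nat.prime_two).mp this)
      have hd : p ∣ u * (u - 1) := by
        rcases Nat.eq_zero_or_pos u with rfl | hpos
        · simp
        · exact ((Nat.modEq_iff_dvd' hpos).mp h.symm).mul_left u
      have := (ZMod.natCast_eq_zero_iff _ p).mpr hd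
      rw [← Nat.div_mul_cancel (Nat.even_mul_pred_self u).two_dvd, ← Nat.choose_two_right,
        Nat.cast_mul] at this
      exact (mul_eq_zero.mp this).resolve_right (by exact_mod_cast h2)
  rw [X_pow_dvd_iff]
  intro d hd
  interval_cases d <;> simp [coeff_one_add_X_pow, coeff_one, coeff_X, hu, hc]

/-- In characteristic different from `p`, an element `σ` of the absolute Galois group acts on the
`p ^ m`-th roots of a Kummer generator through an affine map `k ↦ c + u k` of `ℤ / p ^ m`; the
affine group acts on `𝔽_p[ℤ / p ^ m] = 𝔽_p[X] / (X ^ (p ^ m))`, where `1 + X` is the canonical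
generator of `ℤ / p ^ m`, through the substitutions `f ↦ (1 + X) ^ c * f ((1 + X) ^ u - 1)`. -/
theorem exists_isUnipotentLift_of_char_ne {F K : Type*} [Field F] [Field K] [Algebra F K]
    [IsGalois F K] [IsSepClosed K] (hpF : (p : F) ≠ 0) {ζ₀ : F} (hζ₀ : IsPrimitiveRoot ζ₀ p)
    (hsq : p = 2 → IsSquare (-1 : F)) (n : ℕ) {χ : Gal(K/F) → ZMod p} (hc : Continuous χ)
    (hχ : ∀ σ τ, χ (σ * τ) = χ σ + χ τ) :
    ∃ ρ : Gal(K/F) →* Matrix (Fin (n + 1)) (Fin (n + 1)) (ZMod p), IsUnipotentLift χ ρ := by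
  have hp : p.Prime := Fact.out
  have hpK : (p : K) ≠ 0 := by
    rw [← map_natCast (algebraMap F K)]
    exact (_root_.map_ne_zero _).mpr hpF
  have hqK : NeZero ((p ^ (n + 2) : ℕ) : K) := ⟨by push_cast; exact pow_ne_zero _ hpK⟩
  have hrK : NeZero ((p ^ (n + 1) : ℕ) : K) := ⟨by push_cast; exact pow_ne_zero _ hpK⟩
  have hq0 : NeZero (p ^ (n + 2)) := ⟨pow_ne_zero _ hp.ne_zero⟩
  -- `p ^ (n + 2)` exceeds `n`, so that `X ^ (n + 1)` divides `X ^ p ^ (n + 2)`, and it is divisible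
  -- by `4` if `p = 2`, so that a square root of `-1` is among the powers of `ξ`.
  obtain ⟨ξ, hξ⟩ := HasEnoughRootsOfUnity.exists_primitiveRoot K (p ^ (n + 2))
  have hζ : IsPrimitiveRoot (ξ ^ p ^ (n + 1)) p :=
    hξ.pow hq0.pos (pow_succ p (n + 1))
  have hζfix : ∀ σ : Gal(K/F), σ (ξ ^ p ^ (n + 1)) = ξ ^ p ^ (n + 1) := by
    intro σ
    obtain ⟨i, -, hi⟩ := (hζ₀.map_of_injective (algebraMap F K).injective).eq_pow_of_pow_eq_one
      hζ.pow_eq_one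
    rw [← hi, map_pow, AlgEquiv.commutes]
  obtain ⟨α, hα, hσα⟩ := exists_kummer_generator hc hχ hζ.pow_eq_one hζfix
  obtain ⟨β, rfl⟩ := IsSepClosed.exists_pow_nat_eq α (p ^ (n + 1))
  have hβ : β ≠ 0 := fun h => hα (by rw [h, zero_pow (pow_ne_zero _ hp.ne_zero)])
  -- The exponents are chosen as functions of the conjugates, which makes them locally constant.
  have hlog : ∀ x : K, ∃ k : ℕ, x ^ p ^ (n + 2) = 1 → x = ξ ^ k := fun x => by
    by_cases hx : x ^ p ^ (n + 2) = 1
    · obtain ⟨k, -, hk⟩ := hξ.eq_pow_of_pow_eq_one hx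
      exact ⟨k, fun _ => hk.symm⟩
    · exact ⟨0, fun h => absurd h hx⟩
  choose log hlog using hlog
  let c : Gal(K/F) → ℕ := fun σ => log (σ β / β)
  let u : Gal(K/F) → ℕ := fun σ => log (σ ξ)
  have hu : ∀ σ : Gal(K/F), σ ξ = ξ ^ u σ := fun σ =>
    hlog _ (by rw [← map_pow, hξ.pow_eq_one, map_one])
  have hcβ : ∀ σ : Gal(K/F), σ β = ξ ^ c σ * β := by
    intro σ
    rw [← div_eq_iff hβ]
    refine hlog _ ?_
    have h1 := hσα σ
    rw [map_pow, ← div_eq_iff hα, ← div_pow] at h1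
    rw [pow_succ p (n + 1), pow_mul, h1, ← pow_mul, mul_comm, pow_mul, hζ.pow_eq_one, one_pow]
  have hmod : ∀ {a b : ℕ}, ξ ^ a = ξ ^ b → a ≡ b [MOD p ^ (n + 2)] := fun h => by
    rwa [(hξ.isOfFinOrder hq0.ne).pow_eq_pow_iff_modEq, ← hξ.eq_orderOf] at h
  have hum : ∀ σ τ, u (σ * τ) ≡ u τ * u σ [MOD p ^ (n + 2)] := fun σ τ => by
    refine hmod ?_
    rw [← hu, AlgEquiv.mul_apply, hu τ, map_pow, hu σ, ← pow_mul, mul_comm]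
  have hcm : ∀ σ τ, c (σ * τ) ≡ c σ + u σ * c τ [MOD p ^ (n + 2)] := fun σ τ => by
    refine hmod (mul_right_cancel₀ hβ ?_)
    rw [← hcβ, AlgEquiv.mul_apply, hcβ τ, map_mul, map_pow, hu σ, hcβ σ, ← pow_mul, ← mul_assoc,
      ← pow_add, add_comm]
  have hu1 : u 1 ≡ 1 [MOD p ^ (n + 2)] := hmod (by rw [← hu, AlgEquiv.one_apply, pow_one])
  have hc1 : c 1 ≡ 0 [MOD p ^ (n + 2)] := by
    refine hmod (mul_right_cancel₀ hβ ?_)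
    rw [← hcβ, AlgEquiv.one_apply, pow_zero, one_mul]
  have hup : ∀ σ, u σ ≡ 1 [MOD p] := by
    intro σ
    have h1 := hζfix σ
    rw [map_pow, hu, ← pow_mul, mul_comm, pow_mul] at h1
    conv_rhs at h1 => rw [← pow_one (ξ ^ p ^ (n + 1))]
    rwa [(hζ.isOfFinOrder hp.ne_zero).pow_eq_pow_iff_modEq, ← hζ.eq_orderOf] at h1
  have hu4 : ∀ σ, p = 2 → u σ ≡ 1 [MOD 4] := by
    rintro σ rfl
    obtain ⟨i, hi⟩ := hsq rfl
    have hη : IsPrimitiveRoot (ξ ^ 2 ^ n) 4 := hξ.pow hq0.pos (by ring)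
    have hη2 : (ξ ^ 2 ^ n) ^ 2 = -1 :=
      (hη.pow (by norm_num) (show 4 = 2 * 2 by norm_num)).eq_neg_one_of_two_right
    have hηi : ξ ^ 2 ^ n = algebraMap F K i ∨ ξ ^ 2 ^ n = -algebraMap F K i := by
      rw [← sq_eq_sq_iff_eq_or_eq_neg, hη2, ← map_pow, sq, ← hi, map_neg, map_one]
    have h1 : σ (ξ ^ 2 ^ n) = ξ ^ 2 ^ n := by
      rcases hηi with h | h <;> rw [h] <;> simp
    rw [map_pow, hu, ← pow_mul, mul_comm, pow_mul] at h1
    conv_rhs at h1 => rw [← pow_one (ξ ^ 2 ^ n)]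
    rwa [(hη.isOfFinOrder four_ne_zero).pow_eq_pow_iff_modEq, ← hη.eq_orderOf] at h1
  have hcχ : ∀ σ, (c σ : ZMod p) = χ σ := by
    intro σ
    have h1 := hσα σ
    rw [map_pow, hcβ, mul_pow, ← pow_mul, mul_comm (c σ), pow_mul] at h1
    have h2 := mul_right_cancel₀ hα h1
    rw [(hζ.isOfFinOrder hp.ne_zero).pow_eq_pow_iff_modEq, ← hζ.eq_orderOf,
      ← ZMod.natCast_eq_natCast_iff] at h2
    rw [h2, ZMod.natCast_zmod_val]
  have hle : (X : (ZMod p)[X]) ^ (n + 1) ∣ X ^ p ^ (n + 2) :=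
    pow_dvd_pow _ ((Nat.le_succ _).trans (Nat.lt_pow_self hp.one_lt).le)
  have hdvd : ∀ {a b : ℕ}, a ≡ b [MOD p ^ (n + 2)] →
      (X : (ZMod p)[X]) ^ (n + 1) ∣ (1 + X) ^ a - (1 + X) ^ b := fun h =>
    hle.trans (X_pow_dvd_one_add_X_pow_sub h)
  obtain ⟨ρ, hρ⟩ := exists_isUnipotentLift_of_substitution (n := n)
    (fun σ : Gal(K/F) => (1 + X : (ZMod p)[X]) ^ c σ) (fun σ => (1 + X) ^ u σ - 1)
    ((isLocallyConstant_apply β).comp fun x => (1 + X) ^ log (x / β))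
    ((isLocallyConstant_apply ξ).comp fun x => (1 + X) ^ log x - 1)
    (fun σ => by simp [coeff_one_add_X_pow])
    (fun σ => X_pow_three_dvd_one_add_X_pow_sub (hup σ) (hu4 σ))
    (by simpa using hdvd hc1)
    (by simpa [sub_sub] using hdvd hu1)
    (fun σ τ => by
      have : ((1 + X : (ZMod p)[X]) ^ c τ).comp ((1 + X) ^ u σ - 1) = (1 + X) ^ (u σ * c τ) := by
        simp [pow_mul]
      rw [this, ← pow_add]
      exact hdvd (hcm σ τ))
    (fun σ τ => by
      have : ((1 + X : (ZMod p)[X]) ^ u τ - 1).comp ((1 + X) ^ u σ - 1) =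
          (1 + X) ^ (u τ * u σ) - 1 := by
        simp [pow_mul, pow_right_comm _ (u τ)]
      rw [this, sub_sub_sub_cancel_right]
      exact hdvd (hum σ τ))
  refine ⟨ρ, ?_⟩
  convert hρ using 2 with σ
  rw [coeff_one_add_X_pow, Nat.choose_one_right, hcχ]

end Kummer

/-! ### Characteristic `p` -/

section ArtinSchreier

open PowerSeries

variable {p : ℕ} [Fact p.Prime]

/-- In characteristic `p`, the equation `Φ C = (1 + b X) C`, where `Φ` raises the coefficients to
their `p`-th powers, has a solution `C = 1 + θ X + ⋯` over a separably closed field if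
`θ ^ p - θ = b`. -/
theorem exists_powerSeries_frobenius_eq {K : Type*} [Field K] [IsSepClosed K] [CharP K p] (θ : K) :
    ∃ C : K⟦X⟧, coeff 0 C = 1 ∧ coeff 1 C = θ ∧
      PowerSeries.map (frobenius K p) C = (1 + PowerSeries.C (θ ^ p - θ) * X) * C := by
  have hs : ∀ y : K, ∃ x : K, x ^ p - x = y := fun y => by
    obtain ⟨x, hx⟩ := IsSepClosed.exists_root_C_mul_X_pow_add_C_mul_X_add_C' p p (1 : K) (-1) (-y)
      dvd_rfl (Fact.out : p.Prime).two_le (by simp)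
    exact ⟨x, by linear_combination hx⟩
  choose s hs using hs
  let c : ℕ → K := fun i =>
    Nat.rec 1 (fun i x => if i = 0 then θ else s ((θ ^ p - θ) * x)) i
  have hc0 : c 0 = 1 := rfl
  have hc1 : c 1 = θ := rfl
  have hc : ∀ i, c (i + 1) ^ p - c (i + 1) = (θ ^ p - θ) * c i := by
    rintro (_ | i)
    · rw [zero_add, hc0, hc1, mul_one]
    · exact hs _
  refine ⟨PowerSeries.mk c, by simp [hc0], by simp [hc1], ?_⟩
  ext i
  rw [add_mul, one_mul, mul_assoc, coeff_map, map_add, coeff_C_mul, coeff_mk, frobenius_def]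
  cases i with
  | zero => simp [hc0]
  | succ i =>
    rw [coeff_succ_X_mul, coeff_mk]
    linear_combination hc i

theorem isLocallyConstant_sum {ι T A : Type*} [TopologicalSpace T] [AddCommMonoid A]
    (s : Finset ι) {f : ι → T → A} (hf : ∀ i, IsLocallyConstant (f i)) :
    IsLocallyConstant fun t => ∑ i ∈ s, f i t := by
  classical
  induction s using Finset.induction_on with
  | empty => exact IsLocallyConstant.const 0
  | insert i s hi ih =>
    simp only [Finset.sum_insert hi]
    exact (hf i).add ih

/-- In characteristic `p`, let `C` be the solution of `Φ C = (1 + b X) C` attached to an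
Artin–Schreier generator. Then `σ C / C` is invariant under `Φ`, so that it has coefficients in
`𝔽_p`, and multiplication by this series is the operator attached to `σ`. -/
theorem exists_isUnipotentLift_of_charP {F K : Type*} [Field F] [Field K] [Algebra F K]
    [IsGalois F K] [IsSepClosed K] [CharP K p] (n : ℕ) {χ : Gal(K/F) → ZMod p} (hc : Continuous χ)
    (hχ : ∀ σ τ, χ (σ * τ) = χ σ + χ τ) :
    ∃ ρ : Gal(K/F) →* Matrix (Fin (n + 1)) (Fin (n + 1)) (ZMod p), IsUnipotentLift χ ρ := by
  obtain ⟨θ, hθ⟩ := exists_artinSchreier_generator hc hχ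
  set e := ZMod.castHom (dvd_refl p) K
  have he : ∀ σ : Gal(K/F), (σ : K →+* K).comp e = e := fun σ => Subsingleton.elim _ _
  have hinj : Function.Injective (PowerSeries.map e) := map_injective e e.injective
  obtain ⟨C, hC0, hC1, hC⟩ := exists_powerSeries_frobenius_eq (p := p) θ
  set L : K⟦X⟧ := 1 + PowerSeries.C (θ ^ p - θ) * X with hL
  have hCinv : C * C⁻¹ = 1 := PowerSeries.mul_inv_cancel _ (by
    rw [← coeff_zero_eq_constantCoeff_apply, hC0]
    exact one_ne_zero)
  have hCne : C ≠ 0 := left_ne_zero_of_mul_eq_one hCinv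
  have hLne : L ≠ 0 := fun h => by
    have := congrArg (constantCoeff (R := K)) h
    simp [hL] at this
  have hLfix : ∀ σ : Gal(K/F), PowerSeries.map (σ : K →+* K) L = L := by
    intro σ
    have : σ (θ ^ p - θ) = θ ^ p - θ := by
      rw [map_sub, map_pow, hθ, add_pow_char, ← map_pow, ZMod.pow_card]
      ring
    rw [hL, map_add, map_one, map_mul, map_X, PowerSeries.map_C, RingHom.coe_coe, this]
  let D : Gal(K/F) → K⟦X⟧ := fun σ => PowerSeries.map (σ : K →+* K) C * C⁻¹
  have hDC : ∀ σ : Gal(K/F), D σ * C = PowerSeries.map (σ : K →+* K) C := fun σ => by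
    rw [mul_assoc, mul_comm C⁻¹, hCinv, mul_one]
  have hDfrob : ∀ σ, PowerSeries.map (frobenius K p) (D σ) = D σ := by
    intro σ
    have h1 : (frobenius K p).comp (σ : K →+* K) = (σ : K →+* K).comp (frobenius K p) := by
      ext x
      simp [frobenius_def]
    refine mul_right_cancel₀ (mul_ne_zero hLne hCne) ?_
    rw [← hC, ← map_mul, hDC, hC, mul_left_comm, hDC, ← RingHom.comp_apply, ← PowerSeries.map_comp,
      h1, PowerSeries.map_comp, RingHom.comp_apply, hC, map_mul, hLfix]
  have hex : ∀ σ, ∃ E : (ZMod p)⟦X⟧, PowerSeries.map e E = D σ := by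
    intro σ
    have : ∀ i, ∃ a : ZMod p, e a = coeff i (D σ) := by
      intro i
      have h1 := congrArg (coeff i) (hDfrob σ)
      rw [coeff_map, frobenius_def, ← Subfield.mem_bot_iff_pow_eq_self,
        ← ZMod.fieldRange_castHom_eq_bot p] at h1
      exact h1
    choose a ha using this
    exact ⟨PowerSeries.mk a, by ext i; simp [ha]⟩
  choose E hE using hex
  have hE1 : E 1 = 1 := hinj (by
    rw [hE, map_one]
    have : PowerSeries.map ((1 : Gal(K/F)) : K →+* K) C = C := by ext; simp
    simp only [D, this, hCinv])
  have hEm : ∀ σ τ, E (σ * τ) = E σ * E τ := by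
    intro σ τ
    have h1 : PowerSeries.map (σ : K →+* K) (D τ) = D τ := by
      rw [← hE τ, ← RingHom.comp_apply, ← PowerSeries.map_comp, he]
    refine hinj (mul_right_cancel₀ hCne ?_)
    rw [map_mul, hE, hE, hE, hDC, mul_right_comm, hDC, ← h1, ← map_mul, mul_comm C, hDC]
    ext
    simp
  have hE0 : ∀ σ, coeff 0 (E σ) = 1 := by
    intro σ
    refine e.injective ?_
    have h1 := congrArg (coeff 0) (hDC σ)
    simp only [coeff_mul, Finset.Nat.antidiagonal_zero, Finset.sum_singleton, coeff_map, hC0, map_one,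
      mul_one] at h1
    rw [← coeff_map, hE, h1, map_one]
  have hEχ : ∀ σ, coeff 1 (E σ) = χ σ := by
    intro σ
    refine e.injective ?_
    have h0 : coeff 0 (D σ) = 1 := by rw [← hE, coeff_map, hE0, map_one]
    have h1 := congrArg (coeff 1) (hDC σ)
    simp only [coeff_mul, Finset.Nat.antidiagonal_succ, Finset.Nat.antidiagonal_zero] at h1
    simp [hC0, hC1, h0, hθ] at h1
    rw [← coeff_map, hE]
    exact h1
  have hElc : ∀ i, IsLocallyConstant fun σ => coeff i (E σ) := by
    intro i
    refine IsLocallyConstant.desc (f := fun σ => coeff i (E σ)) e ?_ e.injective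
    have : (e ∘ fun σ => coeff i (E σ)) = fun σ : Gal(K/F) =>
        ∑ x ∈ Finset.HasAntidiagonal.antidiagonal i, σ (coeff x.1 C) * coeff x.2 C⁻¹ := by
      funext σ
      rw [Function.comp_apply, ← coeff_map, hE, coeff_mul]
      rfl
    rw [this]
    exact isLocallyConstant_sum _ fun x =>
      (isLocallyConstant_apply (coeff x.1 C)).comp fun y => y * coeff x.2 C⁻¹
  have hPlc : IsLocallyConstant fun σ => trunc (n + 2) (E σ) :=
    isLocallyConstant_sum (Finset.Ico 0 (n + 2)) fun i => (hElc i).comp (Polynomial.monomial i)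
  obtain ⟨ρ, hρ⟩ := exists_isUnipotentLift_of_substitution (n := n)
    (fun σ : Gal(K/F) => trunc (n + 2) (E σ)) (fun _ => Polynomial.X)
    hPlc
    (IsLocallyConstant.const _)
    (fun σ => by rw [coeff_trunc, if_pos (by omega), hE0])
    (fun σ => by simp)
    (by simp [hE1, trunc_one])
    (by simp)
    (fun σ τ => by
      rw [Polynomial.comp_X, Polynomial.X_pow_dvd_iff]
      intro d hd
      rw [Polynomial.coeff_sub, coeff_trunc, if_pos (by omega), hEm, sub_eq_zero,
        coeff_mul_eq_coeff_trunc_mul_trunc _ _ (show d < n + 2 by omega), ← Polynomial.coe_mul,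
        Polynomial.coeff_coe])
    (fun σ τ => by simp)
  refine ⟨ρ, ?_⟩
  convert hρ using 2 with σ
  rw [coeff_trunc, if_pos (by omega), hEχ]

end ArtinSchreier

/-! ### Absolute Galois groups -/

theorem Z1.apply_mul {p : ℕ} {G : Type*} [Group G] [TopologicalSpace G] [IsTopologicalGroup G]
    (χ : Z1 p G) (g h : G) : χ.1 (g * h) = χ.1 g + χ.1 h := by
  have h1 : χ.1 h - χ.1 (g * h) + χ.1 g = 0 := DFunLike.congr_fun (f := d1 p G χ.1) χ.2 (g, h)
  linear_combination -h1

theorem exists_isUnipotentLift_absGal {p : ℕ} [Fact p.Prime] {F : Type*} [Field F]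
    (hroot : ringChar F ≠ p → ∃ ζ : F, IsPrimitiveRoot ζ p) (hsq : p = 2 → IsSquare (-1 : F))
    (n : ℕ) {χ : AbsGal F → ZMod p} (hc : Continuous χ) (hχ : ∀ σ τ, χ (σ * τ) = χ σ + χ τ) :
    ∃ ρ : AbsGal F →* Matrix (Fin (n + 1)) (Fin (n + 1)) (ZMod p), IsUnipotentLift χ ρ := by
  by_cases hp : ringChar F = p
  · have : CharP F p := hp ▸ ringChar.charP F
    have : CharP (SeparableClosure F) p := charP_of_injective_algebraMap
      (algebraMap F (SeparableClosure F)).injective p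
    exact exists_isUnipotentLift_of_charP n hc hχ
  · obtain ⟨ζ, hζ⟩ := hroot hp
    refine exists_isUnipotentLift_of_char_ne (fun h => ?_) hζ hsq n hc hχ
    rcases (Nat.dvd_prime Fact.out).mp (ringChar.dvd h) with h1 | h1
    · exact CharP.ringChar_ne_one h1
    · exact hp h1

end Massey

theorem mainTheorem3 (p : ℕ) [Fact p.Prime] (n : ℕ) (hn : 3 ≤ n) (F : Type*) [Field F]
    (hroot : ringChar F ≠ p → ∃ ζ : F, IsPrimitiveRoot ζ p)
    (hsq : p = 2 → IsSquare (-1 : F)) :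
    (∀ χ : Massey.H1 p (Massey.AbsGal F),
      Massey.IsDefined (fun _ : Fin n => χ) ∧
        (0 : Massey.H2 p (Massey.AbsGal F)) ∈ Massey.masseyProduct (fun _ : Fin n => χ)) ∧
    (∀ χ : Massey.H1 p (Massey.MaximalProPQuotient p (Massey.AbsGal F)),
      Massey.IsDefined (fun _ : Fin n => χ) ∧
        (0 : Massey.H2 p (Massey.MaximalProPQuotient p (Massey.AbsGal F))) ∈
          Massey.masseyProduct (fun _ : Fin n => χ)) := by
  have hn0 : n ≠ 0 := by omega
  constructor
  · intro χ
    obtain ⟨χ, rfl⟩ := QuotientAddGroup.mk_surjective χ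
    obtain ⟨ρ, hρ⟩ := Massey.exists_isUnipotentLift_absGal hroot hsq n
      (χ := fun σ => -χ.1 σ) (by fun_prop) (fun σ τ => by rw [Massey.Z1.apply_mul, neg_add])
    obtain ⟨M, hM⟩ := hρ.zero_mem_masseyProduct hn0
    exact ⟨⟨M⟩, M, hM⟩
  · intro χ
    obtain ⟨χ, rfl⟩ := QuotientAddGroup.mk_surjective χ
    obtain ⟨ρ, hρ⟩ := Massey.exists_isUnipotentLift_absGal hroot hsq n
      (χ := fun σ => -χ.1 (QuotientGroup.mk σ))
      (χ.1.continuous.comp QuotientGroup.continuous_mk).neg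
      (fun σ τ => by rw [QuotientGroup.mk_mul, Massey.Z1.apply_mul, neg_add])
    obtain ⟨ρ', hρ'⟩ := hρ.exists_quotient (χ := fun g => -χ.1 g)
    obtain ⟨M, hM⟩ := hρ'.zero_mem_masseyProduct hn0
    exact ⟨⟨M⟩, M, hM⟩
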